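/- Let $X$ be a complex Banach space with a Schauder basis, i.e. a sequence $e_1,e_2,\dots$ in $X$ such that every $x\in X$ has a unique norm-convergent expansion $x=\sum_{j=1}^\infty\lambda_j e_j$ with $\lambda_j\in\mathbb{C}$ (the coordinate functionals $x\mapsto\lambda_j$ are then automatically continuous). Let $\mathrm{psc}(X)$ denote the set of all continuous functions $w\colon X\to\mathbb{R}$ that are plurisubharmonic, i.e. satisfy $$w(a)\le\frac1{2\pi}\int_0^{2\pi}w(a+e^{i\theta}b)\,d\theta\qquad\text{for all }a,b\in X,$$ and let $B(x,\varepsilon)$ be the open ball of radius $\varepsilon$ centered at $x$. **Proposition 3.2.** Let $u\colon X\to\mathbb{R}$ be any function. Suppose there is an $\varepsilon>0$ such that for every $x\in X$ there is a $w_x\in\mathrm{psc}(X)$ with $u(y)<w_x(y)$ for all $y\in B(x,\varepsilon)$. Then there is a $w\in\mathrm{psc}(X)$ such that $u(y)<w(y)$ for all $y\in X$. -/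

import Mathlib

/-- A real-valued function `w` is plurisubharmonic on the set `U` (meant to be open) of a complex
normed space: it is upper semicontinuous on `U`, and whenever the closed disc `{a + ζ b : |ζ| ≤ 1}`
lies in `U`, the value `w a` at its centre is at most the mean value of `w` over its boundary
circle.

For a real-valued upper semicontinuous `w` the boundary mean always exists in `[-∞, ∞)`, and the
inequality `w a ≤ mean` forces it to be finite, that is, `w` to be integrable over the circle;
the integrability clause records this. -/
def PlurisubharmonicOn {X : Type*} [NormedAddCommGroup X] [NormedSpace ℂ X]
    (U : Set X) (w : X → ℝ) : Prop :=
  UpperSemicontinuousOn w U ∧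
    ∀ a b : X, (∀ ζ : ℂ, ‖ζ‖ ≤ 1 → a + ζ • b ∈ U) →
      CircleIntegrable (fun ζ : ℂ => w (a + ζ • b)) 0 1 ∧
        w a ≤ Real.circleAverage (fun ζ : ℂ => w (a + ζ • b)) 0 1

/-- `psc U`: the (real-valued) functions that are continuous on the closure of `U` and
plurisubharmonic on `U`. Values outside the closure of `U` play no role. -/
def psc {X : Type*} [NormedAddCommGroup X] [NormedSpace ℂ X] (U : Set X) : Set (X → ℝ) :=
  {w | ContinuousOn w (closure U) ∧ PlurisubharmonicOn U w}

/-!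
`psc univ` is the set of continuous plurisubharmonic functions on `X`. Let `P n` be the partial sum
projections of the basis and `4 δ = ε`. The set `F n = {‖x - P n x‖ ≤ δ, ‖x‖ ≤ n + 1}` lies in the
`δ`-neighbourhood of a compact set `K n`, so a finite maximum `W n` of the given local majorants
dominates `u` on `F n`, and every point lies in some `F n`. The functions `W n` cannot be glued
directly: nothing controls `W n` near a given point as `n` grows, and since `W n` may be unbounded on
bounded sets, subtracting a constant does not help.

The remedy (`exists_psc_cutoff`) is to shrink the tail `x - P x` holomorphically. Put
`g x = max (‖x - P n x‖ / δ) (‖x‖ / (n + 1))`, so that `F n = {g ≤ 1}`, and with `P = P (n + 1)`,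
`W = W (n + 1)` consider
`v x = max_{‖c‖ ≤ 1} W (P x + c (g x)ᵏ (x - P x)) + M (2 g x - 2)`.
Where `g x ≥ 1`, in particular off `F n`, this is at least `W x`. Where `g x ≤ 1 / 2`, the
factor `(g x)ᵏ` moves the argument of `W` so close to `K (n + 1)` that `W ≤ M` there, whence
`v x ≤ 0`. Every point has a neighbourhood on which `g ≤ 1 / 2` for all large `n`, so the sum of the
positive parts of these functions and of `W 0` is locally finite, and it dominates `u`: a point is
served by the first `F n` that contains it.

The function `v` is plurisubharmonic because `g` is an attained supremum of moduli `‖ℓ x‖` of linear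
functionals, and `x ↦ W (P x + c (ℓ x)ᵏ (x - P x))` is the composition of `W` with a holomorphic
map. That such compositions satisfy the submean inequality on every disc is proved by restricting
to a finite-dimensional space, mollifying `W` there to a `C¹` function
(`convolution_mem_psc`), deducing the submean inequality on small circles up to `o(r²)`
(`eventually_le_circleAverage_comp`), and passing to the unit circle by the maximum principle
(`le_circleAverage_of_eventually_le`).
-/

open Filter Topology Set Metric MeasureTheory
open scoped ContDiff Convolution

/-! ### A local criterion for the submean inequality in one variable -/

theorem Differentiable.circleAverage_re {q : ℂ → ℂ} (hq : Differentiable ℂ q) (c : ℂ) (r : ℝ) :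
    Real.circleAverage (fun z ↦ (q z).re) c r = (q c).re := by
  rw [← hq.diffContOnCl.circleAverage (c := c) (R := r)]
  exact Complex.reCLM.circleAverage_comp_comm hq.continuous.continuousOn.circleIntegrable'

/-- Real parts of entire functions are uniformly dense in the continuous functions on the unit
circle. This stands in for the solution of the Dirichlet problem in the disc. -/
theorem exists_differentiable_re_approx {f : ℂ → ℝ} (hf : Continuous f) {ε : ℝ} (hε : 0 < ε) :
    ∃ q : ℂ → ℂ, Differentiable ℂ q ∧ ∀ z, ‖z‖ = 1 → |f z - (q z).re| ≤ ε := by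
  have : Fact (0 < 2 * Real.pi) := ⟨Real.two_pi_pos⟩
  let T : AddCircle (2 * Real.pi) → ℂ := fun x ↦ (AddCircle.toCircle x : ℂ)
  have hT : Continuous T := continuous_subtype_val.comp AddCircle.continuous_toCircle
  let F : C(AddCircle (2 * Real.pi), ℂ) :=
    ⟨fun x ↦ (f (T x) : ℂ), Complex.continuous_ofReal.comp (hf.comp hT)⟩
  have hF : F ∈ (Submodule.span ℂ (range <| @fourier (2 * Real.pi))).topologicalClosure := by
    rw [span_fourier_closure_eq_top]; trivial
  obtain ⟨g, hg, hFg⟩ := Metric.mem_closure_iff.1 hF ε hε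
  -- every trigonometric polynomial has the form `q₁ + conj q₂` with entire `q₁`, `q₂`
  have key : ∃ q₁ q₂ : ℂ → ℂ, Differentiable ℂ q₁ ∧ Differentiable ℂ q₂ ∧
      ∀ x, g x = q₁ (T x) + (starRingEnd ℂ) (q₂ (T x)) := by
    refine Submodule.span_induction (p := fun g _ ↦ ∃ q₁ q₂ : ℂ → ℂ, Differentiable ℂ q₁ ∧
      Differentiable ℂ q₂ ∧ ∀ x, g x = q₁ (T x) + (starRingEnd ℂ) (q₂ (T x))) ?_ ?_ ?_ ?_ hg
    · rintro _ ⟨n, rfl⟩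
      obtain ⟨m, rfl | rfl⟩ := n.eq_nat_or_neg
      · refine ⟨fun z ↦ z ^ m, 0, by fun_prop, differentiable_const 0, fun x ↦ ?_⟩
        simp [fourier_apply, AddCircle.toCircle_nsmul, T]
      · refine ⟨0, fun z ↦ z ^ m, differentiable_const 0, by fun_prop, fun x ↦ ?_⟩
        simp [fourier_apply, AddCircle.toCircle_nsmul, T, AddCircle.toCircle_neg,
          ← Circle.coe_inv_eq_conj]
    · exact ⟨0, 0, differentiable_const 0, differentiable_const 0, fun x ↦ by simp⟩
    · rintro g h _ _ ⟨q₁, q₂, h₁, h₂, h⟩ ⟨p₁, p₂, h₁', h₂', h'⟩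
      refine ⟨q₁ + p₁, q₂ + p₂, h₁.add h₁', h₂.add h₂', fun x ↦ ?_⟩
      simp only [ContinuousMap.add_apply, h, h', Pi.add_apply, map_add]
      ring
    · rintro a g _ ⟨q₁, q₂, h₁, h₂, h⟩
      refine ⟨fun z ↦ a * q₁ z, fun z ↦ (starRingEnd ℂ) a * q₂ z, h₁.const_mul _,
        h₂.const_mul _, fun x ↦ ?_⟩
      simp only [ContinuousMap.smul_apply, h, smul_eq_mul, map_mul, Complex.conj_conj]
      ring
  obtain ⟨q₁, q₂, h₁, h₂, hq⟩ := key
  refine ⟨q₁ + q₂, h₁.add h₂, fun z hz ↦ ?_⟩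
  obtain ⟨x, rfl⟩ : ∃ x, T x = z := by
    refine ⟨(Complex.arg z : ℝ), ?_⟩
    simp only [T, AddCircle.toCircle_apply_mk]
    rw [div_self Real.two_pi_pos.ne', one_mul, Circle.coe_exp]
    have := Complex.norm_mul_exp_arg_mul_I z
    rwa [hz, Complex.ofReal_one, one_mul] at this
  have h := (ContinuousMap.dist_apply_le_dist x).trans hFg.le
  rw [Complex.dist_eq] at h
  refine le_trans ?_ ((Complex.abs_re_le_norm _).trans h)
  rw [hq]
  simp [F]

/-- A continuous function on `ℂ` that satisfies the submean inequality on small circles up to an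
error `o(r²)` satisfies it on the unit circle: after adding a small multiple of `‖z‖²` the
maximum principle applies to its difference with a nearly harmonic majorant. -/
theorem le_circleAverage_of_eventually_le {s : ℂ → ℝ} (hs : Continuous s)
    (h : ∀ z, ∀ κ : ℝ, 0 < κ → ∀ᶠ r in 𝓝[>] (0 : ℝ), s z ≤ Real.circleAverage s z r + κ * r ^ 2) :
    s 0 ≤ Real.circleAverage s 0 1 := by
  refine le_of_forall_pos_le_add fun η hη ↦ ?_
  set κ := η / 3 with hκ
  have hκ0 : 0 < κ := by positivity
  obtain ⟨q, hq, hsq⟩ := exists_differentiable_re_approx hs hκ0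
  let t : ℂ → ℝ := fun z ↦ s z - (q z).re + κ * ‖z‖ ^ 2
  have ht : Continuous t := by
    have := hq.continuous
    fun_prop
  obtain ⟨z₀, hz₀, hmax⟩ := (isCompact_closedBall (0 : ℂ) 1).exists_isMaxOn
    ⟨0, by simp⟩ ht.continuousOn
  have hmax' : ∀ z, ‖z‖ ≤ 1 → t z ≤ t z₀ := fun z hz ↦ hmax (by simpa using hz)
  have hz₀' : ‖z₀‖ ≤ 1 := by simpa using hz₀
  have hz₁ : ‖z₀‖ = 1 := by
    refine le_antisymm hz₀' (not_lt.1 fun hlt ↦ ?_)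
    obtain ⟨r, hr, hr0, hr1⟩ := ((h z₀ (κ / 2) (by positivity)).and
      (Ioo_mem_nhdsGT (sub_pos.2 hlt))).exists
    -- on the circle `‖z - z₀‖ = r`, `‖z‖² = r² - ‖z₀‖² + 2 Re (conj z₀ * z)`
    let Q : ℂ → ℂ := fun z ↦ 2 * κ * ((starRingEnd ℂ) z₀ * z) - q z
    have hQ : Differentiable ℂ Q := by fun_prop
    have hts : EqOn t (fun z ↦ (s z + (Q z).re) + κ * (r ^ 2 - ‖z₀‖ ^ 2)) (sphere z₀ |r|) := by
      intro z hz
      rw [mem_sphere_iff_norm, abs_of_pos hr0] at hz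
      have h1 : r ^ 2 = (z.re - z₀.re) ^ 2 + (z.im - z₀.im) ^ 2 := by
        rw [← hz, Complex.sq_norm, Complex.normSq_apply]; simp; ring
      simp only [t, Q]
      rw [h1, Complex.sq_norm, Complex.sq_norm, Complex.normSq_apply, Complex.normSq_apply]
      simp
      ring
    have hsi : CircleIntegrable s z₀ r := hs.continuousOn.circleIntegrable'
    have hQi : CircleIntegrable (fun z ↦ (Q z).re) z₀ r :=
      (Complex.continuous_re.comp hQ.continuous).continuousOn.circleIntegrable'
    have h2 : Real.circleAverage t z₀ r =
        Real.circleAverage s z₀ r + (Q z₀).re + κ * (r ^ 2 - ‖z₀‖ ^ 2) := by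
      rw [Real.circleAverage_congr_sphere hts, Real.circleAverage_fun_add (f₁ := fun z ↦ s z + (Q z).re) (hsi.add hQi)
        (circleIntegrable_const _ _ _), Real.circleAverage_const,
        Real.circleAverage_fun_add hsi hQi, hQ.circleAverage_re]
    have h3 : Real.circleAverage t z₀ r ≤ t z₀ := by
      refine Real.circleAverage_mono_on_of_le_circle ht.continuousOn.circleIntegrable' fun z hz ↦ ?_
      rw [mem_sphere_iff_norm, abs_of_pos hr0] at hz
      refine hmax' z ?_
      have := norm_add_le (z - z₀) z₀
      rw [sub_add_cancel] at this
      linarith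
    have h4 : (Q z₀).re = 2 * κ * ‖z₀‖ ^ 2 - (q z₀).re := by
      simp only [Q]
      rw [Complex.sq_norm, Complex.normSq_apply]
      simp
    have h5 : 0 < κ * r ^ 2 := by positivity
    rw [h2, h4] at h3
    simp only [t] at h3
    linarith
  have h0 : s 0 - (q 0).re ≤ 2 * κ := by
    have h1 := hmax' 0 (by simp)
    have h2 := (abs_le.1 (hsq z₀ hz₁)).2
    simp only [t, hz₁, norm_zero] at h1
    linarith
  have h1 : (q 0).re ≤ Real.circleAverage s 0 1 + κ := by
    rw [← hq.circleAverage_re 0 1, ← Real.circleAverage_const κ 0 1,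
      ← Real.circleAverage_fun_add hs.continuousOn.circleIntegrable' (circleIntegrable_const _ _ _)]
    refine Real.circleAverage_mono
      (Complex.continuous_re.comp hq.continuous).continuousOn.circleIntegrable'
      (hs.add continuous_const).continuousOn.circleIntegrable' fun z hz ↦ ?_
    have := (abs_le.1 (hsq z (by simpa using hz))).1
    linarith
  linarith

/-! ### Plurisubharmonic functions along entire curves -/

theorem mem_psc_univ_iff {X : Type*} [NormedAddCommGroup X] [NormedSpace ℂ X] {w : X → ℝ} :
    w ∈ psc (univ : Set X) ↔ Continuous w ∧
      ∀ a b : X, w a ≤ Real.circleAverage (fun ζ : ℂ ↦ w (a + ζ • b)) 0 1 := by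
  simp only [psc, PlurisubharmonicOn, mem_ofPred_eq, closure_univ, continuousOn_univ]
  refine ⟨fun h ↦ ⟨h.1, fun a b ↦ (h.2.2 a b fun _ _ ↦ mem_univ _).2⟩,
    fun h ↦ ⟨h.1, h.1.upperSemicontinuous.upperSemicontinuousOn _, fun a b _ ↦ ⟨?_, h.2 a b⟩⟩⟩
  have := h.1
  exact Continuous.continuousOn (by fun_prop) |>.circleIntegrable'

section FiniteDimensional

variable {E : Type*} [NormedAddCommGroup E] [NormedSpace ℂ E]

/-- If `G` is of class `C¹`, then `G ∘ φ` differs from `G` along the tangent line of `φ` by a term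
whose circle average vanishes, up to `o(r²)`; this gives the submean inequality on small circles
with the same error. -/
theorem eventually_le_circleAverage_comp [CompleteSpace E] {G : E → ℝ} (hG : G ∈ psc (univ : Set E))
    (hG1 : ContDiff ℝ 1 G) {φ : ℂ → E} (hφ : Differentiable ℂ φ) (z : ℂ) {κ : ℝ} (hκ : 0 < κ) :
    ∀ᶠ r in 𝓝[>] (0 : ℝ), G (φ z) ≤ Real.circleAverage (G ∘ φ) z r + κ * r ^ 2 := by
  obtain ⟨hGc, hGm⟩ := mem_psc_univ_iff.1 hG
  set B := deriv φ z
  let A : ℂ → E := fun w ↦ φ z + (w - z) • B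
  let L : E →L[ℝ] ℝ := fderiv ℝ G (φ z)
  have hA : Differentiable ℂ A := by fun_prop
  have hstrict : HasStrictFDerivAt G L (φ z) := hG1.hasStrictFDerivAt one_ne_zero
  have hAz : A z = φ z := by simp [A]
  have htend : Tendsto (fun w ↦ (φ w, A w)) (𝓝 z) (𝓝 (φ z, φ z)) := by
    have h1 := hφ.continuous.tendsto z
    have h2 := hA.continuous.tendsto z
    rw [hAz] at h2
    exact h1.prodMk_nhds h2
  let ψ : ℂ → E := dslope (dslope φ z) z
  have hψ : Continuous ψ := by
    have : DifferentiableOn ℂ ψ univ := by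
      rw [Complex.differentiableOn_dslope univ_mem, Complex.differentiableOn_dslope univ_mem]
      exact hφ.differentiableOn
    exact (differentiableOn_univ.1 this).continuous
  have hR : ∀ w, φ w - A w = (w - z) ^ 2 • ψ w := by
    intro w
    rw [pow_two, mul_smul, sub_smul_dslope, smul_sub, sub_smul_dslope, dslope_same]
    simp only [A]
    abel
  have hO : (fun w ↦ φ w - A w) =O[𝓝 z] fun w ↦ (w - z) ^ 2 := by
    simp_rw [hR]
    exact ((Asymptotics.isBigO_refl (fun w ↦ (w - z) ^ 2) (𝓝 z)).smul
      ((hψ.tendsto z).isBigO_one ℂ)).congr_right fun w ↦ mul_one _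
  have ho := (hstrict.isLittleO.comp_tendsto htend).trans_isBigO hO
  obtain ⟨r₀, hr₀, hball⟩ := Metric.eventually_nhds_iff.1 (ho.def hκ)
  filter_upwards [Ioo_mem_nhdsGT hr₀] with r hr
  have hav : Real.circleAverage (G ∘ A) z r ≥ G (φ z) := by
    rw [Real.circleAverage_eq_circleAverage_zero_one]
    refine (hGm (φ z) ((r : ℂ) • B)).trans_eq ?_
    congr 1
    ext ζ
    simp only [A, Function.comp_apply, add_sub_cancel_right, smul_smul, mul_comm]
  have hRd : Differentiable ℂ fun w ↦ φ w - A w := hφ.sub hA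
  have hL : Real.circleAverage (L ∘ fun w ↦ φ w - A w) z r = 0 := by
    rw [L.circleAverage_comp_comm hRd.continuous.continuousOn.circleIntegrable',
      hRd.diffContOnCl.circleAverage, hAz, sub_self, map_zero]
  have hi₁ : CircleIntegrable (G ∘ A) z r :=
    (hGc.comp hA.continuous).continuousOn.circleIntegrable'
  have hi₂ : CircleIntegrable (L ∘ fun w ↦ φ w - A w) z r :=
    (L.continuous.comp hRd.continuous).continuousOn.circleIntegrable'
  have hi₃ : CircleIntegrable (G ∘ φ) z r :=
    (hGc.comp hφ.continuous).continuousOn.circleIntegrable'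
  have hle : Real.circleAverage (G ∘ A + L ∘ fun w ↦ φ w - A w) z r ≤
      Real.circleAverage (fun w ↦ (G ∘ φ) w + κ * r ^ 2) z r := by
    refine Real.circleAverage_mono (hi₁.add hi₂) (hi₃.add (circleIntegrable_const _ _ _))
      fun w hw ↦ ?_
    rw [mem_sphere, abs_of_pos hr.1] at hw
    have h := hball (y := w) (by rw [hw]; exact hr.2)
    rw [norm_pow, ← dist_eq_norm, hw, Real.norm_eq_abs] at h
    have := (abs_le.1 h).1
    simp only [Function.comp_apply, Pi.add_apply] at this ⊢
    linarith
  rw [Real.circleAverage_add hi₁ hi₂, hL, Real.circleAverage_fun_add hi₃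
    (circleIntegrable_const _ _ _), Real.circleAverage_const] at hle
  linarith

/-- Mollification preserves plurisubharmonicity, by Fubini. -/
theorem convolution_mem_psc [FiniteDimensional ℂ E] [MeasurableSpace E] [BorelSpace E]
    (μ : Measure E) [μ.IsAddHaarMeasure] (f : ContDiffBump (0 : E)) {G : E → ℝ}
    (hG : G ∈ psc (univ : Set E)) :
    (f.normed μ ⋆[ContinuousLinearMap.lsmul ℝ ℝ, μ] G : E → ℝ) ∈ psc (univ : Set E) := by
  obtain ⟨hGc, hGm⟩ := mem_psc_univ_iff.1 hG
  have hfc : Continuous (f.normed μ) := f.continuous_normed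
  refine mem_psc_univ_iff.2 ⟨f.hasCompactSupport_normed.continuous_convolution_left _
    f.continuous_normed hGc.locallyIntegrable, fun a b ↦ ?_⟩
  let H : ℝ → E → ℝ := fun θ t ↦ f.normed μ t * G (a + circleMap 0 1 θ • b - t)
  have hH : Continuous (Function.uncurry H) := by
    have : Continuous (circleMap 0 1) := continuous_circleMap 0 1
    simp only [H, Function.uncurry_def]
    fun_prop
  have hint : Integrable (Function.uncurry H)
      ((volume.restrict (uIoc 0 (2 * Real.pi))).prod μ) := by
    have h1 : IntegrableOn (Function.uncurry H)
        (uIcc 0 (2 * Real.pi) ×ˢ tsupport (f.normed μ)) (volume.prod μ) :=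
      hH.continuousOn.integrableOn_compact (isCompact_uIcc.prod f.hasCompactSupport_normed)
    have h2 : IntegrableOn (Function.uncurry H) (uIcc 0 (2 * Real.pi) ×ˢ univ)
        (volume.prod μ) := by
      refine h1.of_forall_sdiff_eq_zero (measurableSet_uIcc.prod MeasurableSet.univ) ?_
      rintro ⟨θ, t⟩ ⟨h, h'⟩
      have : f.normed μ t = 0 := by
        refine image_eq_zero_of_notMem_tsupport fun ht ↦ h' ⟨h.1, ht⟩
      simp [H, this]
    have h3 := h2.mono_set (prod_mono uIoc_subset_uIcc (subset_refl (univ : Set E)))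
    rwa [IntegrableOn, ← Measure.prod_restrict, Measure.restrict_univ] at h3
  have hswap := intervalIntegral_integral_swap hint
  have hle : ∀ t, f.normed μ t * G (a - t) ≤
      (2 * Real.pi)⁻¹ * ∫ θ in (0 : ℝ)..2 * Real.pi, H θ t := by
    intro t
    have h1 := mul_le_mul_of_nonneg_left (hGm (a - t) b) (f.nonneg_normed (μ := μ) t)
    refine h1.trans_eq ?_
    simp only [H, Real.circleAverage_def, smul_eq_mul, intervalIntegral.integral_const_mul]
    rw [mul_left_comm]
    simp_rw [sub_add_eq_add_sub]
  have hi : Integrable (fun t ↦ (2 * Real.pi)⁻¹ * ∫ θ in (0 : ℝ)..2 * Real.pi, H θ t) μ := by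
    have := hint.integral_prod_right
    rw [uIoc_of_le Real.two_pi_pos.le] at this
    simp_rw [intervalIntegral.integral_of_le Real.two_pi_pos.le]
    exact this.const_mul _
  have hi' : Integrable (fun t ↦ f.normed μ t * G (a - t)) μ := by
    have : Continuous fun t ↦ f.normed μ t * G (a - t) := by fun_prop
    exact this.integrable_of_hasCompactSupport f.hasCompactSupport_normed.mul_right
  calc (f.normed μ ⋆[ContinuousLinearMap.lsmul ℝ ℝ, μ] G : E → ℝ) a
      = ∫ t, f.normed μ t * G (a - t) ∂μ := rfl
    _ ≤ ∫ t, ((2 * Real.pi)⁻¹ * ∫ θ in (0 : ℝ)..2 * Real.pi, H θ t) ∂μ := integral_mono hi' hi hle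
    _ = (2 * Real.pi)⁻¹ * ∫ θ in (0 : ℝ)..2 * Real.pi, ∫ t, H θ t ∂μ := by
      rw [integral_const_mul, hswap]
    _ = _ := rfl

/-- A continuous plurisubharmonic function on a finite-dimensional space satisfies the submean
inequality along every entire curve. -/
theorem le_circleAverage_comp_of_finiteDimensional [FiniteDimensional ℂ E] {G : E → ℝ}
    (hG : G ∈ psc (univ : Set E)) {φ : ℂ → E} (hφ : Differentiable ℂ φ) :
    G (φ 0) ≤ Real.circleAverage (G ∘ φ) 0 1 := by
  have : CompleteSpace E := FiniteDimensional.complete ℂ E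
  let _ : MeasurableSpace E := borel E
  have : BorelSpace E := ⟨rfl⟩
  have hGc := (mem_psc_univ_iff.1 hG).1
  refine le_of_forall_pos_le_add fun η hη ↦ ?_
  have hK : IsCompact (φ '' closedBall 0 1) := (isCompact_closedBall _ _).image hφ.continuous
  obtain ⟨ρ, hρ, hunif⟩ := Metric.mem_uniformity_dist.1
    (hK.uniformContinuousAt_of_continuousAt G (fun _ _ ↦ hGc.continuousAt)
      (Metric.dist_mem_uniformity (half_pos hη)))
  let f : ContDiffBump (0 : E) := ⟨ρ / 2, ρ, half_pos hρ, half_lt_self hρ⟩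
  let μ : Measure E := Measure.addHaar
  let g : E → ℝ := f.normed μ ⋆[ContinuousLinearMap.lsmul ℝ ℝ, μ] G
  have hg : g ∈ psc (univ : Set E) := convolution_mem_psc μ f hG
  have hg1 : ContDiff ℝ 1 g := f.hasCompactSupport_normed.contDiff_convolution_left _
    f.contDiff_normed hGc.locallyIntegrable
  have hclose : ∀ z : ℂ, ‖z‖ ≤ 1 → |g (φ z) - G (φ z)| ≤ η / 2 := by
    intro z hz
    refine f.dist_normed_convolution_le hGc.aestronglyMeasurable fun x hx ↦ ?_
    rw [dist_comm]
    rw [mem_ball, dist_comm] at hx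
    exact (hunif hx ⟨z, by simpa using hz, rfl⟩).le
  have hgφ : Continuous (g ∘ φ) := (mem_psc_univ_iff.1 hg).1.comp hφ.continuous
  have hGφ : Continuous (G ∘ φ) := hGc.comp hφ.continuous
  have h1 : g (φ 0) ≤ Real.circleAverage (g ∘ φ) 0 1 := le_circleAverage_of_eventually_le hgφ
    fun z κ hκ ↦ eventually_le_circleAverage_comp hg hg1 hφ z hκ
  have h2 : Real.circleAverage (g ∘ φ) 0 1 ≤ Real.circleAverage (G ∘ φ) 0 1 + η / 2 := by
    rw [← Real.circleAverage_const (η / 2) 0 1, ← Real.circleAverage_fun_add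
      hGφ.continuousOn.circleIntegrable' (circleIntegrable_const _ _ _)]
    refine Real.circleAverage_mono hgφ.continuousOn.circleIntegrable'
      (hGφ.add continuous_const).continuousOn.circleIntegrable' fun z hz ↦ ?_
    have := (abs_le.1 (hclose z (by simpa using (mem_sphere.1 hz).le))).2
    simp only [Function.comp_apply]
    linarith
  have h3 := (abs_le.1 (hclose 0 (by simp))).1
  linarith

end FiniteDimensional

section Banach

variable {X : Type*} [NormedAddCommGroup X] [NormedSpace ℂ X]

theorem comp_affine_mem_psc {E : Type*} [NormedAddCommGroup E] [NormedSpace ℂ E] {w : X → ℝ}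
    (hw : w ∈ psc (univ : Set X)) (p : X) (L : E →L[ℂ] X) :
    (fun x ↦ w (p + L x)) ∈ psc (univ : Set E) := by
  obtain ⟨hc, hm⟩ := mem_psc_univ_iff.1 hw
  refine mem_psc_univ_iff.2 ⟨by fun_prop, fun a b ↦ (hm (p + L a) (L b)).trans_eq ?_⟩
  simp only [map_add, map_smul, add_assoc]

/-- Plurisubharmonicity is preserved under the nonlinear holomorphic substitution that multiplies
the tail `x - P x` by an entire function of a linear functional. -/
theorem comp_add_smul_mem_psc {w : X → ℝ} (hw : w ∈ psc (univ : Set X)) (P : X →L[ℂ] X)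
    (ℓ : X →L[ℂ] ℂ) {h : ℂ → ℂ} (hh : Differentiable ℂ h) :
    (fun x ↦ w (P x + h (ℓ x) • (x - P x))) ∈ psc (univ : Set X) := by
  have hwc := (mem_psc_univ_iff.1 hw).1
  have hhc := hh.continuous
  refine mem_psc_univ_iff.2 ⟨by fun_prop, fun a b ↦ ?_⟩
  -- along a complex line the argument of `w` stays in a translate of a three-dimensional space
  let L : ℂ × ℂ × ℂ →L[ℂ] X :=
    (ContinuousLinearMap.fst ℂ ℂ (ℂ × ℂ)).smulRight (P b) +
    ((ContinuousLinearMap.fst ℂ ℂ ℂ).comp (ContinuousLinearMap.snd ℂ ℂ (ℂ × ℂ))).smulRight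
      (a - P a) +
    ((ContinuousLinearMap.snd ℂ ℂ ℂ).comp (ContinuousLinearMap.snd ℂ ℂ (ℂ × ℂ))).smulRight
      (b - P b)
  let φ : ℂ → ℂ × ℂ × ℂ := fun ζ ↦ (ζ, h (ℓ a + ζ * ℓ b), h (ℓ a + ζ * ℓ b) * ζ)
  have hφ : Differentiable ℂ φ := by
    simp only [φ]
    fun_prop
  have hL : ∀ ζ : ℂ, P a + L (φ ζ) =
      P (a + ζ • b) + h (ℓ (a + ζ • b)) • (a + ζ • b - P (a + ζ • b)) := by
    intro ζ
    simp [L, φ, mul_smul]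
    module
  have key := le_circleAverage_comp_of_finiteDimensional (comp_affine_mem_psc hw (P a) L) hφ
  simpa only [Function.comp_def, hL, zero_smul, add_zero] using key

/-! ### Operations on continuous plurisubharmonic functions -/

theorem const_mem_psc (c : ℝ) : (fun _ ↦ c) ∈ psc (univ : Set X) :=
  mem_psc_univ_iff.2 ⟨continuous_const, fun _ _ ↦ by rw [Real.circleAverage_const]⟩

theorem add_mem_psc {v w : X → ℝ} (hv : v ∈ psc (univ : Set X)) (hw : w ∈ psc (univ : Set X)) :
    (fun x ↦ v x + w x) ∈ psc (univ : Set X) := by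
  obtain ⟨hvc, hvm⟩ := mem_psc_univ_iff.1 hv
  obtain ⟨hwc, hwm⟩ := mem_psc_univ_iff.1 hw
  refine mem_psc_univ_iff.2 ⟨hvc.add hwc, fun a b ↦ ?_⟩
  rw [Real.circleAverage_fun_add (Continuous.continuousOn (by fun_prop)).circleIntegrable'
    (Continuous.continuousOn (by fun_prop)).circleIntegrable']
  exact add_le_add (hvm a b) (hwm a b)

/-- The real part of a continuous affine function is plurisubharmonic. -/
theorem re_affine_mem_psc (ℓ : X →L[ℂ] ℂ) (r s : ℝ) :
    (fun x ↦ r * (ℓ x).re + s) ∈ psc (univ : Set X) := by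
  refine mem_psc_univ_iff.2 ⟨by fun_prop, fun a b ↦ le_of_eq ?_⟩
  have hq : Differentiable ℂ fun ζ : ℂ ↦ r * (ℓ a + ζ * ℓ b) + s := by fun_prop
  have := hq.circleAverage_re 0 1
  simp only [zero_mul, add_zero] at this
  simpa using this.symm

/-- A continuous function that is supported from below, at each point, by a plurisubharmonic
function is plurisubharmonic; in particular this covers continuous attained suprema. -/
theorem mem_psc_of_forall_exists_le {w : X → ℝ} (hw : Continuous w)
    (h : ∀ a, ∃ s ∈ psc (univ : Set X), s a = w a ∧ ∀ x, s x ≤ w x) :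
    w ∈ psc (univ : Set X) := by
  refine mem_psc_univ_iff.2 ⟨hw, fun a b ↦ ?_⟩
  obtain ⟨s, hs, hsa, hle⟩ := h a
  obtain ⟨hsc, hsm⟩ := mem_psc_univ_iff.1 hs
  rw [← hsa]
  exact (hsm a b).trans (Real.circleAverage_mono
    (Continuous.continuousOn (by fun_prop)).circleIntegrable'
    (Continuous.continuousOn (by fun_prop)).circleIntegrable' fun _ _ ↦ hle _)

theorem max_mem_psc {v w : X → ℝ} (hv : v ∈ psc (univ : Set X)) (hw : w ∈ psc (univ : Set X)) :
    (fun x ↦ max (v x) (w x)) ∈ psc (univ : Set X) := by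
  refine mem_psc_of_forall_exists_le
    ((mem_psc_univ_iff.1 hv).1.max (mem_psc_univ_iff.1 hw).1) fun a ↦ ?_
  rcases le_total (v a) (w a) with h | h
  · exact ⟨w, hw, (max_eq_right h).symm, fun x ↦ le_max_right _ _⟩
  · exact ⟨v, hv, (max_eq_left h).symm, fun x ↦ le_max_left _ _⟩

/-- Countably many functions in `psc univ`, all but finitely many of which are nonpositive near any
given point, have a common majorant in `psc univ`: the sum of their positive parts. -/
theorem exists_psc_forall_le {v : ℕ → X → ℝ} (hv : ∀ n, v n ∈ psc (univ : Set X))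
    (hfin : ∀ a, ∃ m, ∀ᶠ x in 𝓝 a, ∀ n ≥ m, v n x ≤ 0) :
    ∃ w ∈ psc (univ : Set X), ∀ n x, v n x ≤ w x := by
  let p : ℕ → X → ℝ := fun n x ↦ max (v n x) 0
  have hp0 : ∀ n x, 0 ≤ p n x := fun n x ↦ le_max_right _ _
  have hS : ∀ m, (fun x ↦ ∑ n ∈ Finset.range m, p n x) ∈ psc (univ : Set X) := by
    intro m
    induction m with
    | zero => simpa using const_mem_psc (X := X) 0
    | succ m ih =>
      simp_rw [Finset.sum_range_succ]
      exact add_mem_psc ih (max_mem_psc (hv m) (const_mem_psc 0))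
  have hloc : ∀ a, ∃ m, ∀ᶠ x in 𝓝 a, ∀ n ∉ Finset.range m, p n x = 0 := by
    intro a
    obtain ⟨m, hm⟩ := hfin a
    exact ⟨m, hm.mono fun x hx n hn ↦ max_eq_right (hx n (by simpa using hn))⟩
  have hsum : ∀ x, Summable fun n ↦ p n x := fun x ↦ by
    obtain ⟨m, hm⟩ := hloc x
    exact summable_of_ne_finset_zero hm.self_of_nhds
  refine ⟨fun x ↦ ∑' n, p n x, mem_psc_of_forall_exists_le ?_ fun a ↦ ?_, fun n x ↦ ?_⟩
  · refine continuous_iff_continuousAt.2 fun a ↦ ?_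
    obtain ⟨m, hm⟩ := hloc a
    exact (mem_psc_univ_iff.1 (hS m)).1.continuousAt.congr
      (hm.mono fun x hx ↦ (tsum_eq_sum hx).symm)
  · obtain ⟨m, hm⟩ := hloc a
    exact ⟨_, hS m, (tsum_eq_sum hm.self_of_nhds).symm,
      fun x ↦ (hsum x).sum_le_tsum _ fun n _ ↦ hp0 n x⟩
  · exact (le_max_left _ _).trans ((hsum x).le_tsum n fun k _ ↦ hp0 k x)

/-! ### Cutting off a plurisubharmonic function -/

/-- Let `g` be a continuous function that is an attained supremum of moduli of linear functionals.
A function `W ∈ psc univ` can be replaced by one that is still at least `W` on `{1 ≤ g}`, but is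
nonpositive at those points of `{g ≤ 1 / 2}` where `W` is at most `M` on a small disc around `P x`
in the direction of `x - P x`. The new function is
`max_{‖c‖ ≤ 1} W (P x + c g(x)ᵏ (x - P x)) + M (2 g(x) - 2)`: the maximum over `c` makes it
monotone in the factor `g(x)ᵏ`, and this factor is tiny on `{g ≤ 1 / 2}` if `k` is large. -/
theorem exists_psc_cutoff {W : X → ℝ} (hW : W ∈ psc (univ : Set X)) (P : X →L[ℂ] X) {g : X → ℝ}
    (hg : Continuous g) (hgl : ∀ a, ∃ ℓ : X →L[ℂ] ℂ, ℓ a = g a ∧ ∀ x, ‖ℓ x‖ ≤ g x)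
    (k : ℕ) {M : ℝ} (hM : 0 ≤ M) :
    ∃ v ∈ psc (univ : Set X), (∀ x, 1 ≤ g x → W x ≤ v x) ∧
      ∀ x, g x ≤ 1 / 2 → (∀ c : ℂ, ‖c‖ ≤ (1 / 2) ^ k → W (P x + c • (x - P x)) ≤ M) → v x ≤ 0 := by
  have hWc := (mem_psc_univ_iff.1 hW).1
  have hg0 : ∀ x, 0 ≤ g x := fun x ↦ by
    obtain ⟨ℓ, -, hℓ⟩ := hgl x
    exact (norm_nonneg _).trans (hℓ x)
  let F : X → ℂ → ℝ := fun x c ↦ W (P x + (c * (g x : ℂ) ^ k) • (x - P x))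
  have hF : Continuous (Function.uncurry F) := by
    simp only [F, Function.uncurry_def]
    fun_prop
  have hFx : ∀ x, Continuous (F x) := fun x ↦ hF.comp (Continuous.prodMk_right x)
  let D : Set ℂ := closedBall 0 1
  have hD : IsCompact D := isCompact_closedBall _ _
  have hDne : D.Nonempty := ⟨0, by simp [D]⟩
  have hle : ∀ x, ∀ c : ℂ, ‖c‖ ≤ 1 → F x c ≤ sSup (F x '' D) := fun x c hc ↦
    le_csSup (hD.image (hFx x)).bddAbove ⟨c, by simpa [D] using hc, rfl⟩
  -- every factor of modulus at most `g(x)ᵏ` is of the form `c * g(x)ᵏ` with `‖c‖ ≤ 1`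
  have hle' : ∀ x, ∀ d : ℂ, ‖d‖ ≤ g x ^ k → W (P x + d • (x - P x)) ≤ sSup (F x '' D) := by
    intro x d hd
    rcases (pow_nonneg (hg0 x) k).eq_or_lt with h | h
    · have hd0 : d = 0 := norm_le_zero_iff.1 (by rwa [← h] at hd)
      simpa [F, hd0] using hle x 0 (by simp)
    · have hne : (g x : ℂ) ^ k ≠ 0 := by exact_mod_cast h.ne'
      have := hle x (d / (g x : ℂ) ^ k) (by
        rw [norm_div, norm_pow, Complex.norm_real, Real.norm_of_nonneg (hg0 x)]
        exact (div_le_one h).2 hd)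
      simpa only [F, div_mul_cancel₀ _ hne] using this
  refine ⟨fun x ↦ sSup (F x '' D) + (2 * M * g x + -2 * M),
    mem_psc_of_forall_exists_le ?_ fun a ↦ ?_, fun x hx ↦ ?_, fun x hx hM' ↦ ?_⟩
  · have := hD.continuous_sSup (f := F) hF
    fun_prop
  · obtain ⟨c, hc, hca⟩ := hD.exists_sSup_image_eq hDne (hFx a).continuousOn
    obtain ⟨ℓ, hℓa, hℓ⟩ := hgl a
    refine ⟨_, add_mem_psc (comp_add_smul_mem_psc hW P ℓ (h := fun z ↦ c * z ^ k) (by fun_prop))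
      (re_affine_mem_psc ℓ (2 * M) (-2 * M)), ?_, fun x ↦ ?_⟩
    · rw [hca, hℓa, Complex.ofReal_re]
    · refine add_le_add (hle' x _ ?_) ?_
      · rw [norm_mul, norm_pow]
        exact (mul_le_of_le_one_left (by positivity) (by simpa [D] using hc)).trans
          (pow_le_pow_left₀ (norm_nonneg _) (hℓ x) k)
      · have := (Complex.re_le_norm (ℓ x)).trans (hℓ x)
        have := mul_le_mul_of_nonneg_left this (by positivity : 0 ≤ 2 * M)
        linarith
  · have h1 := hle' x 1 (by simpa using one_le_pow₀ hx)
    rw [one_smul, add_sub_cancel] at h1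
    have := mul_le_mul_of_nonneg_left hx (by positivity : 0 ≤ 2 * M)
    linarith
  · have h1 : sSup (F x '' D) ≤ M := by
      refine csSup_le (hDne.image _) ?_
      rintro _ ⟨c, hc, rfl⟩
      refine hM' _ ?_
      rw [norm_mul, norm_pow, Complex.norm_real, Real.norm_of_nonneg (hg0 x)]
      exact (mul_le_of_le_one_left (pow_nonneg (hg0 x) k) (by simpa [D] using hc)).trans
        (pow_le_pow_left₀ (hg0 x) hx k)
    have := mul_le_mul_of_nonneg_left hx (by positivity : 0 ≤ 2 * M)
    linarith

/-- The maximum of two norms of linear images of `x` is an attained supremum of moduli of linear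
functionals, by Hahn–Banach. -/
theorem exists_functional_max_norm (S T : X →L[ℂ] X) (a : X) :
    ∃ ℓ : X →L[ℂ] ℂ, ℓ a = (max ‖S a‖ ‖T a‖ : ℝ) ∧ ∀ x, ‖ℓ x‖ ≤ max ‖S x‖ ‖T x‖ := by
  have key : ∀ R : X →L[ℂ] X, ∃ ℓ : X →L[ℂ] ℂ, ℓ a = ‖R a‖ ∧ ∀ x, ‖ℓ x‖ ≤ ‖R x‖ := fun R ↦ by
    obtain ⟨f, hf, hfa⟩ := exists_dual_vector'' ℂ (R a)
    refine ⟨f.comp R, hfa, fun x ↦ ?_⟩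
    simpa using f.le_of_opNorm_le hf (R x)
  rcases le_total ‖S a‖ ‖T a‖ with h | h
  · obtain ⟨ℓ, hℓa, hℓ⟩ := key T
    exact ⟨ℓ, by rw [hℓa, max_eq_right h], fun x ↦ (hℓ x).trans (le_max_right _ _)⟩
  · obtain ⟨ℓ, hℓa, hℓ⟩ := key S
    exact ⟨ℓ, by rw [hℓa, max_eq_left h], fun x ↦ (hℓ x).trans (le_max_left _ _)⟩

/-! ### Neighbourhoods of compact sets -/

/-- On a neighbourhood of uniform width of a compact set, finitely many of the local majorants of
`u` suffice, and their maximum is a single majorant. -/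
theorem IsCompact.exists_psc_gt {K : Set X} (hK : IsCompact K) {u : X → ℝ} {ε : ℝ} (hε : 0 < ε)
    (hu : ∀ x : X, ∃ w ∈ psc (univ : Set X), ∀ y ∈ ball x ε, u y < w y) :
    ∃ w ∈ psc (univ : Set X), ∀ z ∈ K, ∀ y ∈ ball z (ε / 2), u y < w y := by
  refine hK.induction_on ⟨_, const_mem_psc 0, by simp⟩
    (fun s t hst ⟨w, hw, h⟩ ↦ ⟨w, hw, fun z hz ↦ h z (hst hz)⟩) ?_ fun x _ ↦ ?_
  · rintro s t ⟨v, hv, hvs⟩ ⟨w, hw, hwt⟩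
    refine ⟨_, max_mem_psc hv hw, ?_⟩
    rintro z (hz | hz) y hy
    · exact (hvs z hz y hy).trans_le (le_max_left _ _)
    · exact (hwt z hz y hy).trans_le (le_max_right _ _)
  · obtain ⟨w, hw, h⟩ := hu x
    refine ⟨ball x (ε / 2), mem_nhdsWithin_of_mem_nhds (ball_mem_nhds x (half_pos hε)), w, hw,
      fun z hz y hy ↦ h y ?_⟩
    rw [mem_ball] at *
    linarith [dist_triangle y z x]

theorem IsCompact.exists_bound_nhd {Y : Type*} [NormedAddCommGroup Y] {K : Set Y}
    (hK : IsCompact K) {W : Y → ℝ} (hW : Continuous W) :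
    ∃ η > 0, ∃ M ≥ 0, ∀ z ∈ K, ∀ y, ‖y‖ ≤ η → W (z + y) ≤ M := by
  obtain ⟨M, hM⟩ := (hK.image hW).bddAbove
  obtain ⟨ρ, hρ, hunif⟩ := Metric.mem_uniformity_dist.1
    (hK.uniformContinuousAt_of_continuousAt W (fun _ _ ↦ hW.continuousAt)
      (Metric.dist_mem_uniformity one_pos))
  refine ⟨ρ / 2, half_pos hρ, max (M + 1) 0, le_max_right _ _, fun z hz y hy ↦ ?_⟩
  have h1 : dist (W z) (W (z + y)) < 1 := hunif (by rw [dist_self_add_right]; linarith) hz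
  rw [Real.dist_eq] at h1
  have h2 : W z ≤ M := hM ⟨z, hz, rfl⟩
  exact le_max_of_le_left (by linarith [(abs_lt.1 h1).1])

/-! ### Gluing along the finite-dimensional projections -/

/-- Domination under the bounded approximation property: `P n` is a uniformly bounded sequence of
compact operators converging pointwise to the identity. -/
theorem exists_psc_gt_of_tendsto {P : ℕ → X →L[ℂ] X} {C : ℝ} (hC : ∀ n, ‖P n‖ ≤ C)
    (hP : ∀ x, Tendsto (fun n ↦ P n x) atTop (𝓝 x))
    (hcomp : ∀ n (R : ℝ), ∃ K, IsCompact K ∧ ∀ x, ‖x‖ ≤ R → P n x ∈ K)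
    {u : X → ℝ} {ε : ℝ} (hε : 0 < ε)
    (hu : ∀ x : X, ∃ w ∈ psc (univ : Set X), ∀ y ∈ ball x ε, u y < w y) :
    ∃ w ∈ psc (univ : Set X), ∀ x, u x < w x := by
  have hC0 : 0 ≤ C := (norm_nonneg _).trans (hC 0)
  set δ := ε / 4 with hδ
  have hδ0 : 0 < δ := by positivity
  have htail : ∀ n x, ‖x - P n x‖ ≤ (1 + C) * ‖x‖ := fun n x ↦ by
    have := (P n).le_of_opNorm_le (hC n) x
    linarith [norm_sub_le x (P n x)]
  choose K hK hPK using fun n : ℕ ↦ hcomp n (n + 1)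
  choose W hW hWu using fun n ↦ (hK n).exists_psc_gt hε hu
  choose η hη M hM hWM using fun n ↦ (hK n).exists_bound_nhd (mem_psc_univ_iff.1 (hW n)).1
  have hWu' : ∀ n : ℕ, ∀ x, ‖x - P n x‖ ≤ δ → ‖x‖ ≤ n + 1 → u x < W n x := fun n x h1 h2 ↦ by
    refine hWu n _ (hPK n x h2) x ?_
    rw [mem_ball, dist_eq_norm]
    linarith
  -- on the set `{g n ≤ 1}` the function `u` is already dominated by `W n`
  let S : ℕ → X →L[ℂ] X := fun n ↦ ((δ⁻¹ : ℝ) : ℂ) • (ContinuousLinearMap.id ℂ X - P n)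
  let T : ℕ → X →L[ℂ] X := fun n ↦ (((n + 1 : ℝ)⁻¹ : ℝ) : ℂ) • ContinuousLinearMap.id ℂ X
  let g : ℕ → X → ℝ := fun n x ↦ max ‖S n x‖ ‖T n x‖
  have hS : ∀ n x, ‖S n x‖ = ‖x - P n x‖ / δ := fun n x ↦ by
    simp only [S, smul_apply, sub_apply,
      ContinuousLinearMap.id_apply, norm_smul, Complex.norm_real, norm_inv,
      Real.norm_of_nonneg hδ0.le]
    rw [div_eq_inv_mul]
  have hT : ∀ n x, ‖T n x‖ = ‖x‖ / (n + 1) := fun n x ↦ by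
    have : (0 : ℝ) ≤ n + 1 := by positivity
    simp only [T, smul_apply,
      ContinuousLinearMap.id_apply, norm_smul, Complex.norm_real, norm_inv,
      Real.norm_of_nonneg this]
    rw [div_eq_inv_mul]
  have hg : ∀ n, Continuous (g n) := fun n ↦ by fun_prop
  have hk : ∀ n : ℕ, ∃ k : ℕ, (1 / 2 : ℝ) ^ k * ((1 + C) * (n + 1)) ≤ η n := fun n ↦ by
    have h0 : 0 < (1 + C) * ((n : ℝ) + 1) := by positivity
    obtain ⟨k, hk⟩ := exists_pow_lt_of_lt_one (div_pos (hη n) h0) (by norm_num : (1 / 2 : ℝ) < 1)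
    exact ⟨k, ((lt_div_iff₀ h0).1 hk).le⟩
  choose k hk using hk
  choose v hv hvge hvle using fun n ↦ exists_psc_cutoff (hW (n + 1)) (P (n + 1)) (hg n)
    (exists_functional_max_norm (S n) (T n)) (k (n + 1)) (hM (n + 1))
  have hv0 : ∀ n x, g n x ≤ 1 / 2 → v n x ≤ 0 := fun n x hx ↦ by
    refine hvle n x hx fun c hc ↦ ?_
    have hn : (0 : ℝ) < n + 1 := by positivity
    have hx1 : ‖x‖ ≤ (n + 1 : ℕ) + 1 := by
      have := (le_max_right _ _).trans hx
      rw [hT, div_le_iff₀ hn] at this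
      push_cast
      linarith
    refine hWM (n + 1) _ (hPK (n + 1) x hx1) _ ?_
    rw [norm_smul]
    calc ‖c‖ * ‖x - P (n + 1) x‖
        ≤ (1 / 2) ^ k (n + 1) * ((1 + C) * ((n + 1 : ℕ) + 1)) := by
          gcongr
          exact (htail _ _).trans (by gcongr)
      _ ≤ η (n + 1) := hk _
  let V : ℕ → X → ℝ := fun n ↦ Nat.casesOn n (W 0) v
  have hV : ∀ n, V n ∈ psc (univ : Set X) := fun n ↦ by
    cases n with
    | zero => exact hW 0
    | succ n => exact hv n
  obtain ⟨w, hw, hVw⟩ := exists_psc_forall_le hV (fun a ↦ by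
    -- near `a`, both parts of `g n` are at most `1 / 2` for large `n`
    have h1 : ∀ᶠ n in atTop, ‖a - P n a‖ < δ / 4 := by
      have := ((hP a).const_sub a).norm
      rw [sub_self, norm_zero] at this
      exact this.eventually_lt_const (by positivity)
    have h2 : ∀ᶠ n : ℕ in atTop, 2 * (‖a‖ + 1) ≤ n :=
      tendsto_natCast_atTop_atTop.eventually_ge_atTop _
    obtain ⟨m, hm⟩ := eventually_atTop.1 (h1.and h2)
    have hr : 0 < min 1 (δ / (4 * (1 + C))) := by positivity
    refine ⟨m + 1, (ball_mem_nhds a hr |> Filter.eventually_of_mem) fun x hx n hn ↦ ?_⟩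
    obtain ⟨n, rfl⟩ : ∃ j, n = j + 1 := ⟨n - 1, by omega⟩
    obtain ⟨h1, h2⟩ := hm n (by omega)
    rw [mem_ball, dist_eq_norm, lt_min_iff, lt_div_iff₀ (by positivity)] at hx
    have hn0 : (0 : ℝ) < n + 1 := by positivity
    refine hv0 n x (max_le ?_ ?_)
    · rw [hS, div_le_iff₀ hδ0]
      have h3 := htail n (x - a)
      have h4 : x - P n x = (x - a - P n (x - a)) + (a - P n a) := by
        rw [map_sub]; abel
      rw [h4]
      linarith [norm_add_le (x - a - P n (x - a)) (a - P n a)]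
    · rw [hT, div_le_iff₀ hn0]
      have h3 : ‖x‖ ≤ ‖x - a‖ + ‖a‖ := by simpa using norm_add_le (x - a) a
      linarith [hx.1])
  refine ⟨w, hw, fun x ↦ ?_⟩
  -- the first `n` for which `x` is in the set where `W n` dominates `u`
  have hex : ∃ n : ℕ, ‖x - P n x‖ ≤ δ ∧ ‖x‖ ≤ n + 1 := by
    have h1 : ∀ᶠ n in atTop, ‖x - P n x‖ < δ := by
      have := ((hP x).const_sub x).norm
      rw [sub_self, norm_zero] at this
      exact this.eventually_lt_const hδ0
    have h2 : ∀ᶠ n : ℕ in atTop, ‖x‖ ≤ n := tendsto_natCast_atTop_atTop.eventually_ge_atTop _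
    obtain ⟨n, h1, h2⟩ := (h1.and h2).exists
    exact ⟨n, h1.le, by linarith⟩
  classical
  obtain ⟨h1, h2⟩ := Nat.find_spec hex
  rcases hn : Nat.find hex with _ | n
  · rw [hn] at h1 h2
    exact (hWu' 0 x h1 h2).trans_le (hVw 0 x)
  · rw [hn] at h1 h2
    have hnot := Nat.find_min hex (m := n) (by omega)
    refine (hWu' (n + 1) x h1 h2).trans_le ((hvge n x ?_).trans (hVw (n + 1) x))
    have hn0 : (0 : ℝ) < n + 1 := by positivity
    rw [le_max_iff, hS, hT, one_le_div hδ0, one_le_div hn0]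
    by_contra! h
    exact hnot ⟨h.1.le, h.2.le⟩

theorem SchauderBasis.exists_isCompact_proj_mem (b : SchauderBasis ℂ X) (n : ℕ) (R : ℝ) :
    ∃ K, IsCompact K ∧ ∀ x, ‖x‖ ≤ R → b.proj n x ∈ K := by
  have : FiniteDimensional ℂ (b.proj n).toLinearMap.range := by
    rw [b.range_proj_eq_span]
    exact FiniteDimensional.span_of_finite ℂ ((Finset.finite_toSet _).image _)
  have : ProperSpace (b.proj n).toLinearMap.range := FiniteDimensional.proper ℂ _
  refine ⟨_, (isCompact_closedBall (0 : (b.proj n).toLinearMap.range) (‖b.proj n‖ * R)).image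
    continuous_subtype_val, fun x hx ↦ ⟨⟨b.proj n x, x, rfl⟩, ?_, rfl⟩⟩
  rw [mem_closedBall_zero_iff]
  exact (b.proj n).le_opNorm_of_le hx

end Banach

theorem proposition3p2 {X : Type*} [NormedAddCommGroup X] [NormedSpace ℂ X] [CompleteSpace X]
    (hX : Nonempty (SchauderBasis ℂ X)) (u : X → ℝ)
    (hu : ∃ ε : ℝ, 0 < ε ∧
      ∀ x : X, ∃ w ∈ psc (Set.univ : Set X), ∀ y ∈ Metric.ball x ε, u y < w y) :
    ∃ w ∈ psc (Set.univ : Set X), ∀ x : X, u x < w x := by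
  obtain ⟨b⟩ := hX
  obtain ⟨ε, hε, hu⟩ := hu
  obtain ⟨C, hC⟩ := SchauderBasis.exists_norm_proj_le b
  exact exists_psc_gt_of_tendsto hC b.tendsto_proj b.exists_isCompact_proj_mem hε hu
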